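/- Let $n\in\mathbb N$ and let $|\cdot|$ be the Euclidean norm on $\mathbb R^n$. For $T\ge 0$ let $C_T=C((-\infty,T],\mathbb R^n)$ be the Fréchet space of continuous maps with the topology of locally uniform convergence, and let $C=C_0$. For $T>0$ let $C_{0T,0}$ be the Banach space of continuous maps $\eta:[0,T]\to\mathbb R^n$ with $\eta(0)=0$ and with the maximum norm. For $x\in C_T$ and $t\le T$ the segment $x_t\in C$ is given by $x_t(s)=x(t+s)$, $s\le 0$. For $\phi\in C$ let $P_{0T}\phi\in C_T$ be given by $(P_{0T}\phi)(t)=\phi(t)$ for $t\le 0$ and $(P_{0T}\phi)(t)=\phi(0)$ for $0<t\le T$. For $\eta\in C_{0T,0}$ let $Z_T\eta\in C_T$ be given by $Z_T\eta=\eta$ on $[0,T]$ and $Z_T\eta=0$ on $(-\infty,0]$. For topological vector spaces $V_1,V_2$ and an open set $O\subset V_1$, a continuous map $g:O\to V_2$ is $C^1_{MB}$-smooth if all directional derivatives $Dg(u)v=\lim_{0\ne h\to0}\frac1h(g(u+hv)-g(u))$, $u\in O$, $v\in V_1$, exist and $O\times V_1\ni(u,v)\mapsto Dg(u)v\in V_2$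 is continuous. It is $C^1_F$-smooth if all directional derivatives exist, each $Dg(u)$ is linear and continuous, and $u\mapsto Dg(u)$ is continuous from $O$ into the space $L_c(V_1,V_2)$ of continuous linear maps with the topology of uniform convergence on bounded sets. Let $\ast\in\{MB,F\}$, let $U\subset C$ be open, and let $f:U\to\mathbb R^n$ be $C^1_\ast$-smooth. For $T>0$, $\eta\in C_{0T,0}$ and $\phi\in C$ with $(P_{0T}\phi+Z_T\eta)_s\in U$ for all $s\in[0,T]$ (we then say that $B_T(\eta,\phi)$ is defined) put $$B_T(\eta,\phi)(t)=\int_0^t f\big((P_{0T}\phi+Z_T\eta)_s\big)\,ds,\quad 0\le t\le T.$$ Let $\phi\in U$. Call $(\epsilon_\phi,S_\phi,W_\phi)$ admissible for $\phi$ if $\epsilon_\phi>0$, $S_\phi>0$, $W_\phi\subset U$ is an open neighbourhood of $\phi$, and for all $S\in(0,S_\phi]$, all $\chi\in W_\phi$ and all $\eta,\tilde\eta\in C_{0S,0}$ of norm at most $\epsilon_\phi/2$, both $B_S(\eta,\chi)$ and $B_S(\tilde\eta,\chi)$ are defined, $|B_S(\eta,\chi)|<\epsilon_\phi/2$, and $|B_S(\tilde\eta,\chi)-B_S(\eta,\chi)|\le\frac12|\tilde\eta-\eta|$.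 **Proposition 3.5.** Admissible triples for $\phi$ exist. For every admissible triple $(\epsilon_\phi,S_\phi,W_\phi)$ and every $S\in(0,S_\phi]$ the following holds. For each $\chi\in W_\phi$ there is exactly one $\eta_\chi\in C_{0S,0}$ with $|\eta_\chi|\le\epsilon_\phi/2$ and $B_S(\eta_\chi,\chi)=\eta_\chi$. The map $x^{(\chi)}=\Sigma_\phi(\chi)=P_{0S}\chi+Z_S\eta_\chi\in C_S$ is a solution of $x'(t)=f(x_t)$ on $[0,S]$ with $x_0=\chi$; that is, $x^{(\chi)}_t\in U$ for all $t\in[0,S]$, and $x^{(\chi)}|_{[0,S]}$ is differentiable and satisfies the equation at every $t\in[0,S]$ (with one-sided derivatives at the end points). For every $t\in[0,S]$ the map $W_\phi\ni\chi\mapsto x^{(\chi)}_t\in C$ is $C^1_\ast$-smooth. -/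

import Mathlib

open Set Filter Topology

/-- `ℝⁿ` with the Euclidean norm. -/
abbrev Rn (n : ℕ) : Type := EuclideanSpace ℝ (Fin n)

/-- The Fréchet space `C_T = C((-∞, T], ℝⁿ)`. Its topology is the compact-open topology, that is,
the topology of locally uniform convergence. The state space `C` is `CPast n 0`. -/
abbrev CPast (n : ℕ) (T : ℝ) : Type := C(Iic T, Rn n)

/-- The Banach space `C_{0T} = C([0, T], ℝⁿ)` with the maximum norm. -/
abbrev CSeg (n : ℕ) (T : ℝ) : Type := C(Icc (0 : ℝ) T, Rn n)

/-- The closed subspace `C_{0T,0}` of all `η ∈ C_{0T}` with `η 0 = 0`. -/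
def CSegZero (n : ℕ) (T : ℝ) : Submodule ℝ (CSeg n T) where
  carrier := {η | ∀ h : (0 : ℝ) ∈ Icc (0 : ℝ) T, η ⟨0, h⟩ = 0}
  add_mem' := by
    intro a b ha hb h
    simp [ha h, hb h]
  zero_mem' := by
    intro h
    rfl
  smul_mem' := by
    intro c a ha h
    simp [ha h]

section Calculus

variable {V W : Type*} [AddCommGroup V] [Module ℝ V] [TopologicalSpace V]
  [AddCommGroup W] [Module ℝ W] [TopologicalSpace W]

/-- `w` is the directional derivative of `f` at `u` in the direction `v`:
`w = lim_{0 ≠ t → 0} (1/t) (f (u + t v) - f u)`. -/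
def HasDirDeriv (f : V → W) (u v : V) (w : W) : Prop :=
  Tendsto (fun t : ℝ => t⁻¹ • (f (u + t • v) - f u)) (𝓝[≠] 0) (𝓝 w)

/-- `C¹`-smoothness on `U` in the sense of Michal and Bastiani: `f` is continuous on `U`, all
directional derivatives at points of `U` exist, and `(u, v) ↦ Df(u)v` is continuous on `U × V`. -/
def IsC1MB (U : Set V) (f : V → W) : Prop :=
  ContinuousOn f U ∧ ∃ D : V → V → W,
    (∀ u ∈ U, ∀ v, HasDirDeriv f u v (D u v)) ∧
      ContinuousOn (fun p : V × V => D p.1 p.2) (U ×ˢ univ)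

/-- `C¹`-smoothness on `U` in the sense of Fréchet: `f` is continuous on `U`, all directional
derivatives at points `u` of `U` exist, they define continuous linear maps `Df(u)`, and `u ↦ Df(u)`
is continuous on `U` with respect to the topology of uniform convergence on (von Neumann) bounded
sets, which is the topology that `V →L[ℝ] W` carries. -/
def IsC1F [IsTopologicalAddGroup W] [ContinuousConstSMul ℝ W] (U : Set V) (f : V → W) : Prop :=
  ContinuousOn f U ∧ ∃ D : V → (V →L[ℝ] W),
    (∀ u ∈ U, ∀ v, HasDirDeriv f u v (D u v)) ∧ ContinuousOn D U

/-- The two notions of continuous differentiability. -/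
inductive SmoothKind
  | MB
  | F

/-- `C¹_*`-smoothness on `U`, for `* = MB` or `* = F`. -/
def IsC1 [IsTopologicalAddGroup W] [ContinuousConstSMul ℝ W] (k : SmoothKind) (U : Set V)
    (f : V → W) : Prop :=
  match k with
  | SmoothKind.MB => IsC1MB U f
  | SmoothKind.F => IsC1F U f

end Calculus

section Operators

variable {n : ℕ} {T : ℝ}

/-- The segment `x_t ∈ C`, `x_t(s) = x(t + s)` for `s ≤ 0`, of `x ∈ C_T` at `t ≤ T`. -/
def seg (x : CPast n T) (t : Iic T) : CPast n 0 where
  toFun s := x ⟨(t : ℝ) + s, by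
    have h1 : (t : ℝ) ≤ T := t.2
    have h2 : (s : ℝ) ≤ 0 := s.2
    exact mem_Iic.2 (by linarith)⟩
  continuous_toFun := by fun_prop

/-- A point of `[0, T]` as a point of `(-∞, T]`. -/
def toIic (t : Icc (0 : ℝ) T) : Iic T := ⟨t, t.2.2⟩

/-- The prolongation `P_{0T} φ ∈ C_T` of `φ ∈ C` by the constant value `φ(0)` on `[0, T]`. -/
noncomputable def prolong (T : ℝ) (φ : CPast n 0) : CPast n T where
  toFun t := φ ⟨min (t : ℝ) 0, mem_Iic.2 (min_le_right _ _)⟩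
  continuous_toFun := by fun_prop

/-- The prolongation `Z_T η ∈ C_T` of `η ∈ C_{0T,0}` by `0` on `(-∞, 0]`; see
`zeroProlong_of_nonneg` and `zeroProlong_of_nonpos`. -/
noncomputable def zeroProlong (hT : 0 ≤ T) (η : CSegZero n T) : CPast n T where
  toFun t := (η : CSeg n T) (projIcc 0 T hT t)
  continuous_toFun := by fun_prop

theorem zeroProlong_of_nonneg (hT : 0 ≤ T) (η : CSegZero n T) (t : Icc (0 : ℝ) T) :
    zeroProlong hT η (toIic t) = (η : CSeg n T) t := by
  simp [zeroProlong, toIic]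

theorem zeroProlong_of_nonpos (hT : 0 ≤ T) (η : CSegZero n T) (t : Iic T) (ht : (t : ℝ) ≤ 0) :
    zeroProlong hT η t = 0 := by
  have h := η.2 (left_mem_Icc.2 hT)
  simpa [zeroProlong, projIcc_of_le_left hT ht] using h

/-- `J_T(η, φ) = P_{0T} φ + Z_T η`. -/
noncomputable def glue (hT : 0 ≤ T) (η : CSegZero n T) (φ : CPast n 0) : CPast n T :=
  prolong T φ + zeroProlong hT η

/-- `dom_T`: the set of all `ξ ∈ C_T` with `ξ_t ∈ U` for all `t ∈ [0, T]`. -/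
def segDom (U : Set (CPast n 0)) (T : ℝ) : Set (CPast n T) :=
  {ξ | ∀ t : Icc (0 : ℝ) T, seg ξ (toIic t) ∈ U}

theorem continuous_seg (ξ : CPast n T) : Continuous (seg ξ) := by
  have h : Continuous (fun p : Iic T × Iic (0 : ℝ) => seg ξ p.1 p.2) := by
    simp only [seg, ContinuousMap.coe_mk]
    fun_prop
  exact (ContinuousMap.curry ⟨_, h⟩).continuous

open Classical in
/-- The substitution operator `F_T(ξ)(t) = f(ξ_t)` for `0 ≤ t ≤ T`. The value `0` is only taken
where `t ↦ f(ξ_t)` is not continuous, which does not happen for `ξ ∈ dom_T` and `f` continuous on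
`U`; see `substOp_apply`. -/
noncomputable def substOp (f : CPast n 0 → Rn n) (ξ : CPast n T) : CSeg n T :=
  if h : Continuous (fun t : Icc (0 : ℝ) T => f (seg ξ (toIic t))) then ⟨_, h⟩ else 0

theorem substOp_apply {f : CPast n 0 → Rn n} {U : Set (CPast n 0)} (hf : ContinuousOn f U)
    {ξ : CPast n T} (hξ : ξ ∈ segDom U T) (t : Icc (0 : ℝ) T) :
    substOp f ξ t = f (seg ξ (toIic t)) := by
  have h0 : Continuous (fun t : Icc (0 : ℝ) T => seg ξ (toIic t)) :=
    (continuous_seg ξ).comp (by unfold toIic; fun_prop)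
  have h : Continuous (fun t : Icc (0 : ℝ) T => f (seg ξ (toIic t))) :=
    hf.comp_continuous h0 hξ
  simp [substOp, h]

/-- The integration operator `I_T : C_{0T} → C_{0T,0}`, `(I_T g)(t) = ∫₀ᵗ g(s) ds`. -/
noncomputable def integOp (hT : 0 ≤ T) (g : CSeg n T) : CSegZero n T :=
  ⟨⟨fun t => ∫ s in (0 : ℝ)..t, g (projIcc 0 T hT s), by
      have hg : Continuous (fun s : ℝ => g (projIcc 0 T hT s)) := by fun_prop
      exact (intervalIntegral.continuous_primitive
        (fun a b => hg.intervalIntegrable a b) 0).comp continuous_subtype_val⟩, by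
    intro h
    simp⟩

/-- `B_T(η, φ) = I_T(F_T(J_T(η, φ)))`, that is, `B_T(η, φ)(t) = ∫₀ᵗ f((P_{0T} φ + Z_T η)_s) ds`. -/
noncomputable def fixOp (f : CPast n 0 → Rn n) (hT : 0 ≤ T) (η : CSegZero n T) (φ : CPast n 0) :
    CSegZero n T :=
  integOp hT (substOp f (glue hT η φ))

/-- `x ∈ C_T` is a solution of `x'(t) = f(x_t)` on `[0, T]`: all segments `x_t`, `0 ≤ t ≤ T`, belong
to `U`, and the restriction of `x` to `[0, T]` is differentiable and satisfies the equation at every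
`t ∈ [0, T]` (with one-sided derivatives at the end points). -/
def IsSolution (f : CPast n 0 → Rn n) (U : Set (CPast n 0)) (x : CPast n T) : Prop :=
  ∀ t : Icc (0 : ℝ) T, seg x (toIic t) ∈ U ∧
    HasDerivWithinAt (IicExtend x) (f (seg x (toIic t))) (Icc 0 T) t

end Operators

/-- The choice of `ε_φ`, `S_φ` and `W_φ` for the local contraction at `φ ∈ U`: `W` is an open
neighbourhood of `φ` in `U`, and for `0 < S ≤ S₀`, `χ ∈ W`, the map `B_S(·, χ)` is defined on the
closed `ε/2`-ball of `C_{0S,0}`, has values of norm less than `ε/2`, and has Lipschitz constant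
`1/2` there. -/
structure IsContractionData {n : ℕ} (f : CPast n 0 → Rn n) (U : Set (CPast n 0)) (φ : CPast n 0)
    (ε S₀ : ℝ) (W : Set (CPast n 0)) : Prop where
  eps_pos : 0 < ε
  S_pos : 0 < S₀
  isOpen : IsOpen W
  mem : φ ∈ W
  subset : W ⊆ U
  dom : ∀ (S : ℝ) (hS : 0 < S), S ≤ S₀ → ∀ χ ∈ W, ∀ η : CSegZero n S, ‖η‖ ≤ ε / 2 →
    glue hS.le η χ ∈ segDom U S
  bound : ∀ (S : ℝ) (hS : 0 < S), S ≤ S₀ → ∀ χ ∈ W, ∀ η : CSegZero n S, ‖η‖ ≤ ε / 2 →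
    ‖fixOp f hS.le η χ‖ < ε / 2
  contract : ∀ (S : ℝ) (hS : 0 < S), S ≤ S₀ → ∀ χ ∈ W, ∀ η₁ η₂ : CSegZero n S,
    ‖η₁‖ ≤ ε / 2 → ‖η₂‖ ≤ ε / 2 →
      ‖fixOp f hS.le η₁ χ - fixOp f hS.le η₂ χ‖ ≤ 1 / 2 * ‖η₁ - η₂‖

section DirectionalDerivatives

variable {V W : Type*} [AddCommGroup V] [Module ℝ V] [AddCommGroup W] [Module ℝ W]
  [TopologicalSpace W]

theorem HasDirDeriv.unique [T2Space W] {f : V → W} {u v : V} {w w' : W}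
    (h : HasDirDeriv f u v w) (h' : HasDirDeriv f u v w') : w = w' :=
  tendsto_nhds_unique h h'

theorem HasDirDeriv.smul [ContinuousConstSMul ℝ W] {f : V → W} {u v : V} {w : W}
    (h : HasDirDeriv f u v w) (c : ℝ) : HasDirDeriv f u (c • v) (c • w) := by
  rcases eq_or_ne c 0 with rfl | hc
  · simpa [HasDirDeriv] using tendsto_const_nhds
  · have hlim : Tendsto (fun t : ℝ => t * c) (𝓝[≠] 0) (𝓝[≠] 0) := by
      refine tendsto_nhdsWithin_iff.2 ⟨?_, ?_⟩
      · have : Tendsto (fun t : ℝ => t * c) (𝓝 0) (𝓝 (0 * c)) :=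
          (continuous_mul_const c).tendsto 0
        rw [zero_mul] at this
        exact this.mono_left nhdsWithin_le_nhds
      · filter_upwards [self_mem_nhdsWithin] with t ht
        exact mul_ne_zero ht hc
    refine ((Tendsto.comp h hlim).const_smul c).congr fun t => ?_
    simp only [Function.comp_apply, smul_smul, mul_inv]
    congr 1
    field_simp

theorem HasDirDeriv.comp_clm {V' : Type*} [AddCommGroup V'] [Module ℝ V'] {f : V → W}
    (A : V' →ₗ[ℝ] V) {u v : V'} {w : W} (h : HasDirDeriv f (A u) (A v) w) :
    HasDirDeriv (fun x => f (A x)) u v w := by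
  simpa [HasDirDeriv] using h

end DirectionalDerivatives

section MeanValue

variable {V W : Type*} [AddCommGroup V] [Module ℝ V] [NormedAddCommGroup W] [NormedSpace ℝ W]

theorem HasDirDeriv.hasDerivAt {f : V → W} {u v : V} {w : W} {s : ℝ}
    (h : HasDirDeriv f (u + s • v) v w) : HasDerivAt (fun r : ℝ => f (u + r • v)) w s := by
  rw [hasDerivAt_iff_tendsto_slope_zero]
  simpa [HasDirDeriv, add_smul, add_assoc] using h

theorem norm_sub_sub_smul_le_of_hasDirDeriv {f : V → W} {D : V → V → W} {u v : V} {s : Set ℝ}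
    (hs : Convex ℝ s) (hD : ∀ r ∈ s, HasDirDeriv f (u + r • v) v (D (u + r • v) v)) {w : W} {c : ℝ}
    (hc : ∀ r ∈ s, ‖D (u + r • v) v - w‖ ≤ c) {a b : ℝ} (ha : a ∈ s) (hb : b ∈ s) :
    ‖f (u + b • v) - f (u + a • v) - (b - a) • w‖ ≤ c * ‖b - a‖ := by
  have h := Convex.norm_image_sub_le_of_norm_hasDerivWithin_le
    (f := fun r : ℝ => f (u + r • v) - r • w) (f' := fun r => D (u + r • v) v - w)
    (fun r hr => by
      have h := ((hD r hr).hasDerivAt.sub ((hasDerivAt_id r).smul_const w)).hasDerivWithinAt (s := s)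
      rw [one_smul] at h
      exact h)
    hc hs ha hb
  refine le_trans (le_of_eq ?_) h
  congr 1
  simp only [sub_smul]
  abel

end MeanValue

section Classes

variable {V W : Type*} [AddCommGroup V] [Module ℝ V] [TopologicalSpace V]

theorem continuousAt_apply_of_continuousAt [IsTopologicalAddGroup V] [ContinuousSMul ℝ V]
    [FirstCountableTopology V] [NormedAddCommGroup W] [NormedSpace ℝ W] {X : Type*}
    [TopologicalSpace X] [FirstCountableTopology X] {D : X → (V →L[ℝ] W)} {x : X}
    (hD : ContinuousAt D x) (v : V) : ContinuousAt (fun p : X × V => D p.1 p.2) (x, v) := by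
  refine tendsto_of_seq_tendsto fun p hp => ?_
  have h1 : Tendsto (fun k => (p k).1) atTop (𝓝 x) := (continuous_fst.tendsto _).comp hp
  have h2 : Tendsto (fun k => (p k).2) atTop (𝓝 v) := (continuous_snd.tendsto _).comp hp
  have hb := h2.isVonNBounded_range ℝ
  have h3 : Tendsto (fun k => D (p k).1 - D x) atTop (𝓝 0) := by
    simpa using (Tendsto.comp hD h1).sub_const (D x)
  have h4 : Tendsto (fun k => (D (p k).1 - D x) (p k).2) atTop (𝓝 0) := by
    intro N hN
    refine (h3.eventually (ContinuousLinearMap.eventually_nhds_zero_mapsTo hb hN)).mono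
      fun k hk => hk (mem_range_self k)
  have h5 := h4.add (((D x).continuous.tendsto v).comp h2)
  simpa [Function.comp_def] using h5

theorem IsC1F.isC1MB [IsTopologicalAddGroup V] [ContinuousSMul ℝ V]
    [FirstCountableTopology V] [NormedAddCommGroup W] [NormedSpace ℝ W] {U : Set V} (hU : IsOpen U)
    {f : V → W} (hf : IsC1F U f) : IsC1MB U f := by
  obtain ⟨hc, D, hD, hDc⟩ := hf
  refine ⟨hc, fun u v => D u v, hD, ?_⟩
  rintro ⟨u, v⟩ ⟨hu, -⟩
  exact (continuousAt_apply_of_continuousAt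
    (hDc.continuousAt (hU.mem_nhds hu)) v).continuousWithinAt

theorem IsC1.isC1MB [IsTopologicalAddGroup V] [ContinuousSMul ℝ V]
    [FirstCountableTopology V] [NormedAddCommGroup W] [NormedSpace ℝ W] {k : SmoothKind}
    {U : Set V} (hU : IsOpen U) {f : V → W} (hf : IsC1 k U f) : IsC1MB U f := by
  cases k
  · exact hf
  · exact IsC1F.isC1MB hU hf

variable [AddCommGroup W] [Module ℝ W] [TopologicalSpace W] [IsTopologicalAddGroup W]
  [ContinuousConstSMul ℝ W]

theorem IsC1.mono {k : SmoothKind} {U U' : Set V} {f : V → W} (hf : IsC1 k U f) (h : U' ⊆ U) :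
    IsC1 k U' f := by
  cases k
  · obtain ⟨hc, D, hD, hDc⟩ := hf
    exact ⟨hc.mono h, D, fun u hu => hD u (h hu), hDc.mono (prod_mono h Subset.rfl)⟩
  · obtain ⟨hc, D, hD, hDc⟩ := hf
    exact ⟨hc.mono h, D, fun u hu => hD u (h hu), hDc.mono h⟩

theorem IsC1.comp_clm {V' : Type*} [AddCommGroup V'] [Module ℝ V'] [TopologicalSpace V']
    {k : SmoothKind} {U : Set V} {f : V → W} (hf : IsC1 k U f) (A : V' →L[ℝ] V) :
    IsC1 k (A ⁻¹' U) (fun x => f (A x)) := by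
  have hA : MapsTo A (A ⁻¹' U) U := fun _ hx => hx
  cases k
  · obtain ⟨hc, D, hD, hDc⟩ := hf
    refine ⟨hc.comp A.continuous.continuousOn hA, fun u v => D (A u) (A v),
      fun u hu v => (hD _ hu _).comp_clm A.toLinearMap, ?_⟩
    exact hDc.comp (f := fun p : V' × V' => (A p.1, A p.2)) (by fun_prop)
      fun p hp => ⟨hp.1, mem_univ _⟩
  · obtain ⟨hc, D, hD, hDc⟩ := hf
    refine ⟨hc.comp A.continuous.continuousOn hA, fun u => ContinuousLinearMap.precomp W A (D (A u)),
      fun u hu v => (hD _ hu _).comp_clm A.toLinearMap, ?_⟩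
    exact (ContinuousLinearMap.precomp W A).continuous.comp_continuousOn
      (hDc.comp A.continuous.continuousOn hA)

theorem IsC1.clm_comp_add_clm {Z : Type*} [AddCommGroup Z] [Module ℝ Z] [TopologicalSpace Z]
    [IsTopologicalAddGroup Z] [ContinuousConstSMul ℝ Z]
    {k : SmoothKind} {U : Set V} {f : V → W} (hf : IsC1 k U f) (A : W →L[ℝ] Z) (B : V →L[ℝ] Z) :
    IsC1 k U (fun x => A (f x) + B x) := by
  have key : ∀ u v w, HasDirDeriv f u v w →
      HasDirDeriv (fun x => A (f x) + B x) u v (A w + B v) := by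
    intro u v w h
    refine (((A.continuous.tendsto w).comp h).add_const (B v)).congr' ?_
    filter_upwards [self_mem_nhdsWithin] with t ht
    have ht : t ≠ 0 := ht
    simp only [Function.comp_apply, map_smul, map_sub, map_add, smul_sub, smul_add,
      inv_smul_smul₀ ht]
    abel
  cases k
  · obtain ⟨hc, D, hD, hDc⟩ := hf
    refine ⟨(A.continuous.comp_continuousOn hc).add B.continuous.continuousOn,
      fun u v => A (D u v) + B v, fun u hu v => key _ _ _ (hD u hu v), ?_⟩
    exact (A.continuous.comp_continuousOn hDc).add
      (B.continuous.comp continuous_snd).continuousOn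
  · obtain ⟨hc, D, hD, hDc⟩ := hf
    refine ⟨(A.continuous.comp_continuousOn hc).add B.continuous.continuousOn,
      fun u => ContinuousLinearMap.postcomp V A (D u) + B,
      fun u hu v => key _ _ _ (hD u hu v), ?_⟩
    exact ((ContinuousLinearMap.postcomp V A).continuous.comp_continuousOn hDc).add
      continuousOn_const

theorem IsC1.clm_comp {Z : Type*} [AddCommGroup Z] [Module ℝ Z] [TopologicalSpace Z]
    [IsTopologicalAddGroup Z] [ContinuousConstSMul ℝ Z]
    {k : SmoothKind} {U : Set V} {f : V → W} (hf : IsC1 k U f) (A : W →L[ℝ] Z) :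
    IsC1 k U (fun x => A (f x)) := by
  simpa using hf.clm_comp_add_clm A 0

end Classes

section Nemytskii

variable {K V W : Type*} [TopologicalSpace K] [TopologicalSpace V]

open Classical in
/-- The superposition operator `y ↦ f ∘ y` on continuous maps, with the value `0` where `f ∘ y` is
not continuous. -/
noncomputable def nemytskii [TopologicalSpace W] [Zero W] (f : V → W) (y : C(K, V)) : C(K, W) :=
  if h : Continuous (fun t => f (y t)) then ⟨_, h⟩ else 0

theorem nemytskii_apply [TopologicalSpace W] [Zero W] {f : V → W} {U : Set V}
    (hf : ContinuousOn f U) {y : C(K, V)} (hy : MapsTo y univ U) (t : K) :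
    nemytskii f y t = f (y t) := by
  have h : Continuous (fun t => f (y t)) :=
    hf.comp_continuous y.continuous fun t => hy (mem_univ t)
  simp [nemytskii, h]

theorem isOpen_setOf_mapsTo_univ [CompactSpace K] {U : Set V} (hU : IsOpen U) :
    IsOpen {y : C(K, V) | MapsTo y univ U} :=
  ContinuousMap.isOpen_setOfPred_mapsTo isCompact_univ hU

theorem eventually_forall_of_compactSpace [CompactSpace K] {X : Type*} [TopologicalSpace X]
    {x : X} {P : X → K → Prop} (h : ∀ t, ∀ᶠ z : X × K in 𝓝 (x, t), P z.1 z.2) :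
    ∀ᶠ x' in 𝓝 x, ∀ t, P x' t :=
  (isCompact_univ.eventually_forall_of_forall_eventually fun t _ => h t).mono
    fun _ h t => h t (mem_univ t)

theorem continuousAt_eval [LocallyCompactSpace K] (y : C(K, V)) (t : K) :
    ContinuousAt (fun p : C(K, V) × K => p.1 p.2) (y, t) :=
  (by fun_prop : Continuous fun p : C(K, V) × K => p.1 p.2).continuousAt

theorem continuous_apply_eval [TopologicalSpace W] {U : Set V} {D : V → V → W}
    (hD : ContinuousOn (fun p : V × V => D p.1 p.2) (U ×ˢ univ)) {y : C(K, V)}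
    (hy : MapsTo y univ U) (z : C(K, V)) : Continuous fun t => D (y t) (z t) :=
  hD.comp_continuous (f := fun t => (y t, z t)) (by fun_prop)
    fun t => ⟨hy (mem_univ t), mem_univ _⟩

theorem continuousAt_apply_eval [LocallyCompactSpace K] [TopologicalSpace W] {U : Set V}
    (hU : IsOpen U) {D : V → V → W}
    (hD : ContinuousOn (fun p : V × V => D p.1 p.2) (U ×ˢ univ)) {y : C(K, V)}
    (hy : MapsTo y univ U) (z : C(K, V)) (t : K) :
    ContinuousAt (fun p : (C(K, V) × C(K, V)) × K => D (p.1.1 p.2) (p.1.2 p.2)) ((y, z), t) := by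
  have h1 : ContinuousAt (fun p : V × V => D p.1 p.2) (y t, z t) :=
    hD.continuousAt ((hU.prod isOpen_univ).mem_nhds ⟨hy (mem_univ t), mem_univ _⟩)
  exact ContinuousAt.comp (g := fun p : V × V => D p.1 p.2)
    (f := fun p : (C(K, V) × C(K, V)) × K => (p.1.1 p.2, p.1.2 p.2)) h1
    (by fun_prop : Continuous fun p : (C(K, V) × C(K, V)) × K =>
      (p.1.1 p.2, p.1.2 p.2)).continuousAt

theorem eventually_mapsTo_univ [CompactSpace K] {U : Set V} (hU : IsOpen U) {y : C(K, V)}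
    (hy : MapsTo y univ U) : ∀ᶠ y' : C(K, V) in 𝓝 y, MapsTo y' univ U :=
  (isOpen_setOf_mapsTo_univ hU).mem_nhds hy

theorem Bornology.IsVonNBounded.setOf_eval [CompactSpace K] [AddCommGroup V]
    [Module ℝ V] [IsTopologicalAddGroup V] [ContinuousSMul ℝ V] {s : Set C(K, V)}
    (hs : Bornology.IsVonNBounded ℝ s) :
    Bornology.IsVonNBounded ℝ {x : V | ∃ z ∈ s, ∃ t, z t = x} := by
  intro N hN
  have hN' : {z : C(K, V) | MapsTo z univ (interior N)} ∈ 𝓝 (0 : C(K, V)) :=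
    (isOpen_setOf_mapsTo_univ isOpen_interior).mem_nhds
      fun t _ => mem_interior_iff_mem_nhds.2 hN
  refine Eventually.mono (hs hN') fun c hc => ?_
  rintro x ⟨z, hz, t, rfl⟩
  obtain ⟨z', hz', rfl⟩ := hc hz
  exact ⟨z' t, interior_subset (hz' (mem_univ t)), rfl⟩

variable [CompactSpace K] [NormedAddCommGroup W]

theorem ContinuousMap.continuousAt_of_continuousAt_uncurry {X : Type*} [TopologicalSpace X]
    {F : X → C(K, W)} {x : X} (h : ∀ t, ContinuousAt (fun p : X × K => F p.1 p.2) (x, t)) :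
    ContinuousAt F x := by
  rw [ContinuousAt, Metric.tendsto_nhds]
  intro ε hε
  have key : ∀ᶠ x' in 𝓝 x, ∀ t, dist (F x' t) (F x t) < ε / 2 := by
    refine eventually_forall_of_compactSpace fun t => ?_
    have h1 : ContinuousAt (fun p : X × K => dist (F p.1 p.2) (F x p.2)) (x, t) :=
      (h t).dist ((F x).continuous.comp continuous_snd).continuousAt
    have h2 := h1.tendsto
    simp only [dist_self] at h2
    exact h2.eventually (gt_mem_nhds (half_pos hε))
  filter_upwards [key] with x' hx'
  exact lt_of_le_of_lt ((ContinuousMap.dist_le (half_pos hε).le).2 fun t => (hx' t).le)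
    (half_lt_self hε)

theorem continuousOn_nemytskii [LocallyCompactSpace K] {f : V → W} {U : Set V} (hU : IsOpen U) (hf : ContinuousOn f U) :
    ContinuousOn (nemytskii f : C(K, V) → C(K, W)) {y | MapsTo y univ U} := by
  intro y hy
  have hy : MapsTo y univ U := hy
  refine (ContinuousMap.continuousAt_of_continuousAt_uncurry fun t => ?_).continuousWithinAt
  have h1 : ContinuousAt (fun p : C(K, V) × K => f (p.1 p.2)) (y, t) :=
    ContinuousAt.comp (g := f) (hf.continuousAt (hU.mem_nhds (hy (mem_univ t))))
      (continuousAt_eval y t)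
  refine h1.congr ?_
  have h2 : ∀ᶠ p : C(K, V) × K in 𝓝 (y, t), MapsTo p.1 univ U :=
    continuous_fst.continuousAt.eventually (eventually_mapsTo_univ hU hy)
  filter_upwards [h2] with p hp
  exact (nemytskii_apply hf hp p.2).symm

variable [AddCommGroup V] [Module ℝ V] [NormedSpace ℝ W] [IsTopologicalAddGroup V]
  [ContinuousSMul ℝ V]

variable [LocallyCompactSpace K]

theorem hasDirDeriv_nemytskii {f : V → W} {U : Set V} (hU : IsOpen U) (hf : ContinuousOn f U)
    {D : V → V → W} (hfD : ∀ u ∈ U, ∀ v, HasDirDeriv f u v (D u v))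
    (hD : ContinuousOn (fun p : V × V => D p.1 p.2) (U ×ˢ univ)) {y : C(K, V)}
    (hy : MapsTo y univ U) (z : C(K, V)) {w : C(K, W)} (hw : ∀ t, w t = D (y t) (z t)) :
    HasDirDeriv (nemytskii f) y z w := by
  rw [HasDirDeriv, Metric.tendsto_nhds]
  intro ε hε
  have hline : Continuous fun s : ℝ => y + s • z := by fun_prop
  have hline0 : Tendsto (fun s : ℝ => y + s • z) (𝓝 0) (𝓝 y) := by
    simpa using hline.tendsto 0
  have h1 : ∀ᶠ s : ℝ in 𝓝 0, MapsTo (y + s • z) univ U :=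
    hline0.eventually (eventually_mapsTo_univ hU hy)
  have h2 : ∀ᶠ s : ℝ in 𝓝 0, ∀ t, dist (D ((y + s • z) t) (z t)) (D (y t) (z t)) < ε / 2 := by
    refine eventually_forall_of_compactSpace fun t => ?_
    have h3 : ContinuousAt (fun p : (C(K, V) × C(K, V)) × K => D (p.1.1 p.2) (p.1.2 p.2))
        ((y + (0 : ℝ) • z, z), t) := by
      rw [zero_smul, add_zero]
      exact continuousAt_apply_eval hU hD hy z t
    have h4 : ContinuousAt (fun p : ℝ × K => D ((y + p.1 • z) p.2) (z p.2)) (0, t) :=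
      ContinuousAt.comp
        (g := fun p : (C(K, V) × C(K, V)) × K => D (p.1.1 p.2) (p.1.2 p.2))
        (f := fun p : ℝ × K => ((y + p.1 • z, z), p.2)) h3
        (by fun_prop : Continuous fun p : ℝ × K => ((y + p.1 • z, z), p.2)).continuousAt
    have h5 := (h4.dist (g := fun p : ℝ × K => D (y p.2) (z p.2))
      ((continuous_apply_eval hD hy z).comp continuous_snd).continuousAt)
    simp only [Function.comp_apply, zero_smul, add_zero, dist_self] at h5
    exact h5.eventually (gt_mem_nhds (half_pos hε))
  obtain ⟨δ, hδ, hball⟩ := Metric.eventually_nhds_iff_ball.1 (h1.and h2)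
  rw [eventually_nhdsWithin_iff]
  filter_upwards [Metric.ball_mem_nhds (0 : ℝ) hδ] with s hs hs0
  have hs0 : s ≠ 0 := hs0
  refine lt_of_le_of_lt ((ContinuousMap.dist_le (half_pos hε).le).2 fun t => ?_) (half_lt_self hε)
  have h0 : (0 : ℝ) ∈ Metric.ball (0 : ℝ) δ := Metric.mem_ball_self hδ
  have hm := norm_sub_sub_smul_le_of_hasDirDeriv (f := f) (D := D) (u := y t) (v := z t)
    (convex_ball (0 : ℝ) δ) (fun r hr => hfD _ ((hball r hr).1 (mem_univ t)) _)
    (w := w t) (c := ε / 2) (fun r hr => by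
      have := (hball r hr).2 t
      rw [hw, ← dist_eq_norm]
      exact this.le) h0 hs
  have e1 : nemytskii f (y + s • z) t = f (y t + s • z t) :=
    nemytskii_apply hf (hball s hs).1 t
  have e2 : nemytskii f y t = f (y t) := nemytskii_apply hf hy t
  simp only [ContinuousMap.smul_apply, ContinuousMap.sub_apply, e1, e2]
  simp only [zero_smul, add_zero, sub_zero] at hm
  have e3 : s⁻¹ • (f (y t + s • z t) - f (y t)) - w t
      = s⁻¹ • (f (y t + s • z t) - f (y t) - s • w t) := by
    rw [smul_sub _ _ (s • w t), inv_smul_smul₀ hs0]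
  rw [dist_eq_norm, e3, norm_smul, norm_inv, inv_mul_le_iff₀ (norm_pos_iff.2 hs0), mul_comm]
  exact hm

theorem isC1MB_nemytskii {f : V → W} {U : Set V} (hU : IsOpen U) (hf : IsC1MB U f) :
    IsC1MB {y : C(K, V) | MapsTo y univ U} (nemytskii f : C(K, V) → C(K, W)) := by
  classical
  obtain ⟨hc, D, hfD, hD⟩ := hf
  let DF : C(K, V) → C(K, V) → C(K, W) := fun y z =>
    if h : MapsTo y univ U then ⟨_, continuous_apply_eval hD h z⟩ else 0
  have hDF : ∀ y : C(K, V), MapsTo y univ U → ∀ z t, DF y z t = D (y t) (z t) := by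
    intro y hy z t
    simp only [DF]
    rw [dif_pos hy]
    rfl
  refine ⟨continuousOn_nemytskii hU hc, DF,
    fun y hy z => hasDirDeriv_nemytskii hU hc hfD hD hy z (hDF y hy z), ?_⟩
  rintro ⟨y, z⟩ ⟨hy, -⟩
  have hy : MapsTo y univ U := hy
  refine (ContinuousMap.continuousAt_of_continuousAt_uncurry fun t => ?_).continuousWithinAt
  refine (continuousAt_apply_eval hU hD hy z t).congr ?_
  have h2 : ∀ᶠ p : (C(K, V) × C(K, V)) × K in 𝓝 ((y, z), t), MapsTo p.1.1 univ U :=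
    ((continuous_fst.comp continuous_fst).tendsto ((y, z), t)).eventually
      (eventually_mapsTo_univ hU hy)
  filter_upwards [h2] with p hp
  exact (hDF _ hp _ _).symm

theorem isC1F_nemytskii [FirstCountableTopology V] {f : V → W} {U : Set V} (hU : IsOpen U)
    (hf : IsC1F U f) :
    IsC1F {y : C(K, V) | MapsTo y univ U} (nemytskii f : C(K, V) → C(K, W)) := by
  classical
  obtain ⟨hc, D, hfD, hDF⟩ := hf
  have hD : ContinuousOn (fun p : V × V => D p.1 p.2) (U ×ˢ univ) := by
    rintro ⟨u, v⟩ ⟨hu, -⟩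
    exact (continuousAt_apply_of_continuousAt
      (hDF.continuousAt (hU.mem_nhds hu)) v).continuousWithinAt
  let A (y : C(K, V)) (hy : MapsTo y univ U) : C(K, V) →L[ℝ] C(K, W) :=
    { toFun := fun z => ⟨_, continuous_apply_eval (D := fun u v => D u v) hD hy z⟩
      map_add' := fun z z' => by
        ext1 t
        exact map_add (D (y t)) (z t) (z' t)
      map_smul' := fun c z => by
        ext1 t
        exact map_smul (D (y t)) c (z t)
      cont := by
        refine continuous_iff_continuousAt.2 fun z => ?_
        refine ContinuousMap.continuousAt_of_continuousAt_uncurry fun t => ?_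
        exact ContinuousAt.comp
          (g := fun p : (C(K, V) × C(K, V)) × K => D (p.1.1 p.2) (p.1.2 p.2))
          (f := fun p : C(K, V) × K => ((y, p.1), p.2))
          (continuousAt_apply_eval (D := fun u v => D u v) hU hD hy z t)
          (by fun_prop : Continuous fun p : C(K, V) × K => ((y, p.1), p.2)).continuousAt }
  let DN : C(K, V) → (C(K, V) →L[ℝ] C(K, W)) := fun y =>
    if h : MapsTo y univ U then A y h else 0
  have hDN : ∀ y : C(K, V), MapsTo y univ U → ∀ z t, DN y z t = D (y t) (z t) := by
    intro y hy z t
    simp only [DN]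
    rw [dif_pos hy]
    rfl
  refine ⟨continuousOn_nemytskii hU hc, DN,
    fun y hy z => hasDirDeriv_nemytskii hU hc hfD hD hy z (hDN y hy z), ?_⟩
  intro y hy
  have hy : MapsTo y univ U := hy
  refine ContinuousAt.continuousWithinAt ?_
  rw [ContinuousAt, ← tendsto_sub_nhds_zero_iff,
    ContinuousLinearMap.hasBasis_nhds_zero.tendsto_right_iff]
  rintro ⟨s, N⟩ ⟨hs, hN⟩
  obtain ⟨ε, hε, hεN⟩ := Metric.mem_nhds_iff.1 hN
  have hb := hs.setOf_eval
  have h1 : ∀ᶠ y' in 𝓝 y, ∀ t, MapsTo (D (y' t) - D (y t)) {x : V | ∃ z ∈ s, ∃ t, z t = x}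
      (Metric.ball 0 (ε / 2)) := by
    refine eventually_forall_of_compactSpace fun t => ?_
    have c1 : ContinuousAt D (y t) := hDF.continuousAt (hU.mem_nhds (hy (mem_univ t)))
    have h2 : ContinuousAt (fun p : C(K, V) × K => D (p.1 p.2)) (y, t) :=
      ContinuousAt.comp (g := D) c1 (continuousAt_eval y t)
    have h3 : ContinuousAt (fun p : C(K, V) × K => D (y p.2)) (y, t) :=
      ContinuousAt.comp (g := D) (f := fun p : C(K, V) × K => y p.2) c1
        (by fun_prop : Continuous fun p : C(K, V) × K => y p.2).continuousAt
    have h4 : Tendsto (fun p : C(K, V) × K => D (p.1 p.2) - D (y p.2)) (𝓝 (y, t)) (𝓝 0) := by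
      have h5 := (h2.sub h3).tendsto
      simp only [Pi.sub_apply, sub_self] at h5
      exact h5
    exact h4.eventually (ContinuousLinearMap.eventually_nhds_zero_mapsTo hb
      (Metric.ball_mem_nhds 0 (half_pos hε)))
  filter_upwards [h1, eventually_mapsTo_univ hU hy] with y' h1' hy' z hz
  refine hεN ?_
  rw [mem_ball_zero_iff]
  refine lt_of_le_of_lt ((ContinuousMap.norm_le _ (half_pos hε).le).2 fun t => ?_)
    (half_lt_self hε)
  have := h1' t ⟨z, hz, t, rfl⟩
  rw [mem_ball_zero_iff] at this
  have e : (DN y' - DN y) z t = (D (y' t) - D (y t)) (z t) := by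
    simp [hDN y' hy', hDN y hy]
  exact e ▸ this.le

theorem isC1_nemytskii [FirstCountableTopology V] {k : SmoothKind} {f : V → W} {U : Set V}
    (hU : IsOpen U) (hf : IsC1 k U f) :
    IsC1 k {y : C(K, V) | MapsTo y univ U} (nemytskii f : C(K, V) → C(K, W)) := by
  cases k
  · exact isC1MB_nemytskii hU hf
  · exact isC1F_nemytskii hU hf

end Nemytskii

section ParametricContraction

variable {E X : Type*} [NormedAddCommGroup E]

theorem norm_sub_le_two_mul_of_le_half {a b c d : E} (h : ‖c - d‖ ≤ 1 / 2 * ‖a - b‖) :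
    ‖a - b‖ ≤ 2 * ‖d - b - (c - a)‖ := by
  have e : a - b = (c - d) + (d - b - (c - a)) := by abel
  have h1 : ‖a - b‖ ≤ ‖c - d‖ + ‖d - b - (c - a)‖ := by
    conv_lhs => rw [e]
    exact norm_add_le _ _
  linarith

theorem exists_fixedPoint_of_norm_le [CompleteSpace E] {g : E → E} {r : ℝ} (hr : 0 ≤ r)
    (hmap : ∀ x, ‖x‖ ≤ r → ‖g x‖ ≤ r)
    (hlip : ∀ x y, ‖x‖ ≤ r → ‖y‖ ≤ r → ‖g x - g y‖ ≤ 1 / 2 * ‖x - y‖) :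
    ∃ x, ‖x‖ ≤ r ∧ g x = x := by
  have hm : MapsTo g (Metric.closedBall 0 r) (Metric.closedBall 0 r) := by
    intro x hx
    rw [mem_closedBall_zero_iff] at hx ⊢
    exact hmap x hx
  have hc : ContractingWith (1 / 2) (hm.restrict g _ _) := by
    refine ⟨by norm_num, LipschitzWith.of_dist_le_mul ?_⟩
    rintro ⟨x, hx⟩ ⟨y, hy⟩
    rw [mem_closedBall_zero_iff] at hx hy
    simpa [Subtype.dist_eq, dist_eq_norm] using hlip x y hx hy
  obtain ⟨x, hx, hfix, -⟩ := hc.exists_fixedPoint' Metric.isClosed_closedBall.isComplete hm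
    (Metric.mem_closedBall_self hr) (edist_ne_top _ _)
  exact ⟨x, mem_closedBall_zero_iff.1 hx, hfix⟩

theorem exists_fixedPoint_of_norm_sub_le [CompleteSpace E] {g : E → E}
    (hlip : ∀ x y, ‖g x - g y‖ ≤ 1 / 2 * ‖x - y‖) : ∃ x, g x = x := by
  have hc : ContractingWith (1 / 2) g := by
    refine ⟨by norm_num, LipschitzWith.of_dist_le_mul fun x y => ?_⟩
    simpa [dist_eq_norm] using hlip x y
  exact ⟨_, hc.fixedPoint_isFixedPt⟩

variable [TopologicalSpace X] {G : E × X → E} {r : ℝ} {W : Set X} {η : X → E}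

theorem continuousOn_fixedPoint (hW : IsOpen W)
    (hlip : ∀ χ ∈ W, ∀ x y, ‖x‖ ≤ r → ‖y‖ ≤ r → ‖G (x, χ) - G (y, χ)‖ ≤ 1 / 2 * ‖x - y‖)
    (hη : ∀ χ ∈ W, ‖η χ‖ < r ∧ G (η χ, χ) = η χ)
    (hG : ContinuousOn G (Metric.ball 0 r ×ˢ W)) : ContinuousOn η W := by
  intro χ hχ
  refine ContinuousAt.continuousWithinAt ?_
  have h1 : ContinuousAt G (η χ, χ) := hG.continuousAt
    ((Metric.isOpen_ball.prod hW).mem_nhds ⟨mem_ball_zero_iff.2 (hη χ hχ).1, hχ⟩)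
  have h2 : Tendsto (fun χ' => G (η χ, χ')) (𝓝 χ) (𝓝 (η χ)) := by
    have h3 := h1.tendsto.comp
      ((by fun_prop : Continuous fun χ' => (η χ, χ')).tendsto χ)
    rwa [(hη χ hχ).2] at h3
  rw [ContinuousAt, tendsto_iff_norm_sub_tendsto_zero]
  have h4 := (tendsto_iff_norm_sub_tendsto_zero.1 h2).const_mul 2
  rw [mul_zero] at h4
  refine squeeze_zero' (Eventually.of_forall fun _ => norm_nonneg _) ?_ h4
  filter_upwards [hW.mem_nhds hχ] with χ' hχ'
  have h5 := norm_sub_le_two_mul_of_le_half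
    (hlip χ' hχ' (η χ') (η χ) (hη χ' hχ').1.le (hη χ hχ).1.le)
  rwa [(hη χ' hχ').2, sub_self, sub_zero] at h5

variable [NormedSpace ℝ E] [AddCommGroup X] [Module ℝ X] [IsTopologicalAddGroup X]
  [ContinuousSMul ℝ X]

theorem eventually_add_smul_mem {V : Type*} [TopologicalSpace V] [AddCommGroup V] [Module ℝ V]
    [ContinuousAdd V] [ContinuousSMul ℝ V] {O : Set V} (hO : IsOpen O) {u : V} (hu : u ∈ O)
    (v : V) : ∀ᶠ t : ℝ in 𝓝[≠] 0, u + t • v ∈ O := by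
  have h : Tendsto (fun t : ℝ => u + t • v) (𝓝 0) (𝓝 u) := by
    simpa using (by fun_prop : Continuous fun t : ℝ => u + t • v).tendsto 0
  exact nhdsWithin_le_nhds (h.eventually (hO.mem_nhds hu))

theorem hasDirDeriv_fixedPoint (hW : IsOpen W)
    (hlip : ∀ χ ∈ W, ∀ x y, ‖x‖ ≤ r → ‖y‖ ≤ r → ‖G (x, χ) - G (y, χ)‖ ≤ 1 / 2 * ‖x - y‖)
    (hη : ∀ χ ∈ W, ‖η χ‖ < r ∧ G (η χ, χ) = η χ) {χ : X} (hχ : χ ∈ W) {v : X} {ζ : E}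
    (hζ : HasDirDeriv G (η χ, χ) (ζ, v) ζ) : HasDirDeriv η χ v ζ := by
  rw [HasDirDeriv, tendsto_iff_norm_sub_tendsto_zero]
  have h4 := (tendsto_iff_norm_sub_tendsto_zero.1 hζ).const_mul 2
  rw [mul_zero] at h4
  refine squeeze_zero' (Eventually.of_forall fun _ => norm_nonneg _) ?_ h4
  filter_upwards [eventually_add_smul_mem (Metric.isOpen_ball.prod hW)
    (⟨mem_ball_zero_iff.2 (hη χ hχ).1, hχ⟩ : (η χ, χ) ∈ Metric.ball 0 r ×ˢ W) (ζ, v),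
    self_mem_nhdsWithin] with t ht ht0
  have ht0 : t ≠ 0 := ht0
  obtain ⟨ht1, ht2⟩ := ht
  simp only [Prod.smul_mk, Prod.mk_add_mk, mem_ball_zero_iff] at ht1 ht2 ⊢
  have h5 := norm_sub_le_two_mul_of_le_half
    (hlip _ ht2 (η (χ + t • v)) (η χ + t • ζ) (hη _ ht2).1.le ht1.le)
  rw [(hη _ ht2).2, sub_self, sub_zero] at h5
  have e1 : t⁻¹ • (η (χ + t • v) - η χ) - ζ = t⁻¹ • (η (χ + t • v) - (η χ + t • ζ)) := by
    rw [← sub_sub, smul_sub _ _ (t • ζ), inv_smul_smul₀ ht0]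
  have e2 : t⁻¹ • (G (η χ + t • ζ, χ + t • v) - η χ) - ζ
      = t⁻¹ • (G (η χ + t • ζ, χ + t • v) - (η χ + t • ζ)) := by
    rw [← sub_sub, smul_sub _ _ (t • ζ), inv_smul_smul₀ ht0]
  rw [(hη χ hχ).2, e1, e2, norm_smul, norm_smul]
  calc ‖t⁻¹‖ * ‖η (χ + t • v) - (η χ + t • ζ)‖
      ≤ ‖t⁻¹‖ * (2 * ‖G (η χ + t • ζ, χ + t • v) - (η χ + t • ζ)‖) := by gcongr
    _ = _ := by ring

theorem HasDirDeriv.norm_sub_le_half (hW : IsOpen W)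
    (hlip : ∀ χ ∈ W, ∀ x y, ‖x‖ ≤ r → ‖y‖ ≤ r → ‖G (x, χ) - G (y, χ)‖ ≤ 1 / 2 * ‖x - y‖)
    {p : E × X} (hp : p ∈ Metric.ball 0 r ×ˢ W) {v : X} {ζ ζ' w w' : E}
    (hw : HasDirDeriv G p (ζ, v) w) (hw' : HasDirDeriv G p (ζ', v) w') :
    ‖w - w'‖ ≤ 1 / 2 * ‖ζ - ζ'‖ := by
  obtain ⟨x, χ⟩ := p
  refine le_of_tendsto (Tendsto.sub hw hw').norm ?_
  have hO : IsOpen (Metric.ball (0 : E) r ×ˢ W) := Metric.isOpen_ball.prod hW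
  filter_upwards [eventually_add_smul_mem hO hp (ζ, v), eventually_add_smul_mem hO hp (ζ', v),
    self_mem_nhdsWithin] with t ⟨h1, h2⟩ ⟨h1', _⟩ ht0
  have ht0 : t ≠ 0 := ht0
  simp only [Prod.smul_mk, Prod.mk_add_mk, mem_ball_zero_iff] at h1 h2 h1' ⊢
  have h3 := hlip _ h2 _ _ h1.le h1'.le
  rw [add_sub_add_left_eq_sub, ← smul_sub, norm_smul] at h3
  rw [← smul_sub, sub_sub_sub_cancel_right, norm_smul, norm_inv,
    inv_mul_le_iff₀ (norm_pos_iff.2 ht0)]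
  linarith

theorem exists_hasDirDeriv_fixedPoint [CompleteSpace E] (hW : IsOpen W)
    (hlip : ∀ χ ∈ W, ∀ x y, ‖x‖ ≤ r → ‖y‖ ≤ r → ‖G (x, χ) - G (y, χ)‖ ≤ 1 / 2 * ‖x - y‖)
    {D : E × X → E × X → E}
    (hD : ∀ p ∈ Metric.ball (0 : E) r ×ˢ W, ∀ q, HasDirDeriv G p q (D p q))
    (hη : ∀ χ ∈ W, ‖η χ‖ < r ∧ G (η χ, χ) = η χ) :
    ∃ ζ : X → X → E, ∀ χ ∈ W, ∀ v, D (η χ, χ) (ζ χ v, v) = ζ χ v ∧ HasDirDeriv η χ v (ζ χ v) := by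
  have h : ∀ χ v, ∃ ζ, χ ∈ W → D (η χ, χ) (ζ, v) = ζ := by
    intro χ v
    by_cases hχ : χ ∈ W
    · have hp : (η χ, χ) ∈ Metric.ball (0 : E) r ×ˢ W := ⟨mem_ball_zero_iff.2 (hη χ hχ).1, hχ⟩
      obtain ⟨ζ, hζ⟩ := exists_fixedPoint_of_norm_sub_le (g := fun ζ => D (η χ, χ) (ζ, v))
        fun x y => (hD _ hp (x, v)).norm_sub_le_half hW hlip hp (hD _ hp (y, v))
      exact ⟨ζ, fun _ => hζ⟩
    · exact ⟨0, fun h => absurd h hχ⟩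
  choose ζ hζ using h
  refine ⟨ζ, fun χ hχ v => ⟨hζ χ v hχ, hasDirDeriv_fixedPoint hW hlip hη hχ ?_⟩⟩
  have h1 := hD (η χ, χ) ⟨mem_ball_zero_iff.2 (hη χ hχ).1, hχ⟩ (ζ χ v, v)
  rwa [hζ χ v hχ] at h1

theorem isC1MB_fixedPoint [CompleteSpace E] (hW : IsOpen W)
    (hlip : ∀ χ ∈ W, ∀ x y, ‖x‖ ≤ r → ‖y‖ ≤ r → ‖G (x, χ) - G (y, χ)‖ ≤ 1 / 2 * ‖x - y‖)
    (hη : ∀ χ ∈ W, ‖η χ‖ < r ∧ G (η χ, χ) = η χ)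
    (hG : IsC1MB (Metric.ball 0 r ×ˢ W) G) : IsC1MB W η := by
  obtain ⟨hc, D, hD, hDc⟩ := hG
  have hcη := continuousOn_fixedPoint hW hlip hη hc
  have hmem : ∀ χ ∈ W, (η χ, χ) ∈ Metric.ball (0 : E) r ×ˢ W :=
    fun χ hχ => ⟨mem_ball_zero_iff.2 (hη χ hχ).1, hχ⟩
  obtain ⟨ζ, hζ⟩ := exists_hasDirDeriv_fixedPoint hW hlip hD hη
  refine ⟨hcη, ζ, fun χ hχ v => (hζ χ hχ v).2, ?_⟩
  rintro ⟨χ, v⟩ ⟨hχ, -⟩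
  refine ContinuousAt.continuousWithinAt ?_
  have h1 : ContinuousAt (fun p : (E × X) × (E × X) => D p.1 p.2) ((η χ, χ), (ζ χ v, v)) :=
    hDc.continuousAt (((Metric.isOpen_ball.prod hW).prod isOpen_univ).mem_nhds
      ⟨hmem χ hχ, mem_univ _⟩)
  have h2 : ContinuousAt (fun q : X × X => ((η q.1, q.1), (ζ χ v, q.2))) (χ, v) := by
    have h3 : ContinuousAt (fun q : X × X => η q.1) (χ, v) :=
      ContinuousAt.comp (f := Prod.fst) (g := η) (hcη.continuousAt (hW.mem_nhds hχ))
        continuous_fst.continuousAt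
    exact (h3.prodMk continuous_fst.continuousAt).prodMk
      (continuousAt_const.prodMk continuous_snd.continuousAt)
  have h4 : Tendsto (fun q : X × X => D (η q.1, q.1) (ζ χ v, q.2)) (𝓝 (χ, v)) (𝓝 (ζ χ v)) := by
    have h5 := h1.tendsto.comp h2.tendsto
    rwa [(hζ χ hχ v).1] at h5
  rw [ContinuousAt, tendsto_iff_norm_sub_tendsto_zero]
  have h6 := (tendsto_iff_norm_sub_tendsto_zero.1 h4).const_mul 2
  rw [mul_zero] at h6
  refine squeeze_zero' (Eventually.of_forall fun _ => norm_nonneg _) ?_ h6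
  have h7 : ∀ᶠ q : X × X in 𝓝 (χ, v), q.1 ∈ W :=
    (continuous_fst.tendsto (χ, v)).eventually (hW.mem_nhds hχ)
  filter_upwards [h7] with ⟨χ', v'⟩ hχ'
  have h8 := norm_sub_le_two_mul_of_le_half ((hD _ (hmem χ' hχ') (ζ χ' v', v')).norm_sub_le_half
    hW hlip (hmem χ' hχ') (hD _ (hmem χ' hχ') (ζ χ v, v')))
  rwa [(hζ χ' hχ' v').1, sub_self, sub_zero] at h8

theorem isC1F_fixedPoint [CompleteSpace E] (hW : IsOpen W)
    (hlip : ∀ χ ∈ W, ∀ x y, ‖x‖ ≤ r → ‖y‖ ≤ r → ‖G (x, χ) - G (y, χ)‖ ≤ 1 / 2 * ‖x - y‖)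
    (hη : ∀ χ ∈ W, ‖η χ‖ < r ∧ G (η χ, χ) = η χ)
    (hG : IsC1F (Metric.ball 0 r ×ˢ W) G) : IsC1F W η := by
  classical
  obtain ⟨hc, D, hD, hDc⟩ := hG
  have hcη := continuousOn_fixedPoint hW hlip hη hc
  have hmem : ∀ χ ∈ W, (η χ, χ) ∈ Metric.ball (0 : E) r ×ˢ W :=
    fun χ hχ => ⟨mem_ball_zero_iff.2 (hη χ hχ).1, hχ⟩
  obtain ⟨ζ, hζ⟩ := exists_hasDirDeriv_fixedPoint (D := fun p q => D p q) hW hlip hD hη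
  have hle : ∀ χ ∈ W, ∀ v x, ‖ζ χ v - x‖ ≤ 2 * ‖D (η χ, χ) (x, v) - x‖ := by
    intro χ hχ v x
    have h8 := norm_sub_le_two_mul_of_le_half ((hD _ (hmem χ hχ) (ζ χ v, v)).norm_sub_le_half
      hW hlip (hmem χ hχ) (hD _ (hmem χ hχ) (x, v)))
    rwa [(hζ χ hχ v).1, sub_self, sub_zero] at h8
  have huniq : ∀ χ ∈ W, ∀ v x, D (η χ, χ) (x, v) = x → ζ χ v = x := by
    intro χ hχ v x hx
    have h := hle χ hχ v x
    rw [hx, sub_self, norm_zero, mul_zero] at h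
    exact sub_eq_zero.1 (norm_le_zero_iff.1 h)
  let A (χ : X) (hχ : χ ∈ W) : X →ₗ[ℝ] E :=
    { toFun := ζ χ
      map_add' := fun v w => by
        refine huniq χ hχ _ _ ?_
        rw [← Prod.mk_add_mk, map_add, (hζ χ hχ v).1, (hζ χ hχ w).1]
      map_smul' := fun c v => by
        refine huniq χ hχ _ _ ?_
        rw [RingHom.id_apply, ← Prod.smul_mk, map_smul, (hζ χ hχ v).1] }
  have hA : ∀ χ hχ, Continuous (A χ hχ) := by
    intro χ hχ
    refine continuous_of_continuousAt_zero (A χ hχ) ?_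
    rw [ContinuousAt, map_zero, tendsto_zero_iff_norm_tendsto_zero]
    have h1 : Tendsto (fun v => 2 * ‖D (η χ, χ) (0, v)‖) (𝓝 0) (𝓝 0) := by
      have h2 : Continuous fun v => 2 * ‖D (η χ, χ) (0, v)‖ := by fun_prop
      have h3 := h2.tendsto 0
      rwa [Prod.mk_zero_zero, map_zero, norm_zero, mul_zero] at h3
    refine squeeze_zero (fun _ => norm_nonneg _) (fun v => ?_) h1
    have h := hle χ hχ v 0
    rw [sub_zero, sub_zero] at h
    exact h
  let Z : X → (X →L[ℝ] E) := fun χ => if h : χ ∈ W then ⟨A χ h, hA χ h⟩ else 0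
  have hZ : ∀ χ ∈ W, ∀ v, Z χ v = ζ χ v := by
    intro χ hχ v
    simp only [Z]
    rw [dif_pos hχ]
    rfl
  refine ⟨hcη, Z, fun χ hχ v => hZ χ hχ v ▸ (hζ χ hχ v).2, ?_⟩
  intro χ hχ
  refine ContinuousAt.continuousWithinAt ?_
  rw [ContinuousAt, ← tendsto_sub_nhds_zero_iff,
    ContinuousLinearMap.hasBasis_nhds_zero.tendsto_right_iff]
  rintro ⟨s, N⟩ ⟨hs, hN⟩
  obtain ⟨ε, hε, hεN⟩ := Metric.mem_nhds_iff.1 hN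
  have hb := hs.image ((Z χ).prod (ContinuousLinearMap.id ℝ X))
  have h1 : Tendsto (fun χ' => D (η χ', χ') - D (η χ, χ)) (𝓝 χ) (𝓝 0) := by
    have h2 : ContinuousAt D (η χ, χ) :=
      hDc.continuousAt ((Metric.isOpen_ball.prod hW).mem_nhds (hmem χ hχ))
    have h3 : ContinuousAt (fun χ' => (η χ', χ')) χ :=
      (hcη.continuousAt (hW.mem_nhds hχ)).prodMk continuousAt_id
    exact tendsto_sub_nhds_zero_iff.2 (h2.tendsto.comp h3.tendsto)
  filter_upwards [h1.eventually (ContinuousLinearMap.eventually_nhds_zero_mapsTo hb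
    (Metric.ball_mem_nhds 0 (half_pos hε))), hW.mem_nhds hχ] with χ' h2 hχ' v hv
  refine hεN ?_
  have h3 := h2 (mem_image_of_mem _ hv)
  have h4 := hle χ' hχ' v (ζ χ v)
  rw [mem_ball_zero_iff] at h3 ⊢
  have e : (D (η χ', χ') - D (η χ, χ)) (((Z χ).prod (ContinuousLinearMap.id ℝ X)) v)
      = D (η χ', χ') (ζ χ v, v) - ζ χ v := by
    have := (hζ χ hχ v).1
    simp [hZ χ hχ, this]
  rw [e] at h3
  rw [sub_apply, hZ χ hχ, hZ χ' hχ']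
  linarith

theorem isC1_fixedPoint [CompleteSpace E] {k : SmoothKind} (hW : IsOpen W)
    (hlip : ∀ χ ∈ W, ∀ x y, ‖x‖ ≤ r → ‖y‖ ≤ r → ‖G (x, χ) - G (y, χ)‖ ≤ 1 / 2 * ‖x - y‖)
    (hη : ∀ χ ∈ W, ‖η χ‖ < r ∧ G (η χ, χ) = η χ)
    (hG : IsC1 k (Metric.ball 0 r ×ˢ W) G) : IsC1 k W η := by
  cases k
  · exact isC1MB_fixedPoint hW hlip hη hG
  · exact isC1F_fixedPoint hW hlip hη hG

end ParametricContraction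

section Operators

variable {n : ℕ} {S : ℝ}

instance instLocallyCompactSpaceIic (a : ℝ) : LocallyCompactSpace (Iic a) :=
  isClosed_Iic.isClosedEmbedding_subtypeVal.locallyCompactSpace

instance instSigmaCompactSpaceIic (a : ℝ) : SigmaCompactSpace (Iic a) :=
  isClosed_Iic.isClosedEmbedding_subtypeVal.sigmaCompactSpace

theorem firstCountableTopology_cPast (n : ℕ) (T : ℝ) : FirstCountableTopology (CPast n T) :=
  inferInstance

theorem completeSpace_cSegZero (n : ℕ) (T : ℝ) : CompleteSpace (CSegZero n T) := by
  have h : IsClosed (CSegZero n T : Set (CSeg n T)) := by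
    have e : (CSegZero n T : Set (CSeg n T))
        = ⋂ h : (0 : ℝ) ∈ Icc (0 : ℝ) T, {η | η ⟨0, h⟩ = 0} := by
      ext η
      simp [CSegZero]
    rw [e]
    exact isClosed_iInter fun h => isClosed_eq (by fun_prop) continuous_const
  exact h.completeSpace_coe

/-- The map sending `x ∈ C_S` to the curve of its segments `t ↦ x_t`, `0 ≤ t ≤ S`. -/
def segMap (n : ℕ) (S : ℝ) : CPast n S →L[ℝ] C(Icc (0 : ℝ) S, CPast n 0) where
  toFun ξ := ⟨fun t => seg ξ (toIic t), (continuous_seg ξ).comp (by unfold toIic; fun_prop)⟩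
  map_add' _ _ := rfl
  map_smul' _ _ := rfl
  cont := by
    refine ContinuousMap.continuous_of_continuous_uncurry _
      (ContinuousMap.continuous_of_continuous_uncurry _ ?_)
    simp only [Function.uncurry_def, seg, toIic, ContinuousMap.coe_mk]
    fun_prop

/-- `glue` as a continuous linear map. -/
noncomputable def glueCLM (n : ℕ) (hS : 0 ≤ S) : CSegZero n S × CPast n 0 →L[ℝ] CPast n S where
  toFun p := glue hS p.1 p.2
  map_add' p q := by
    ext1 t
    simp only [glue, prolong, zeroProlong, ContinuousMap.add_apply, ContinuousMap.coe_mk,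
      Prod.fst_add, Prod.snd_add, Submodule.coe_add]
    abel
  map_smul' c p := by
    ext1 t
    simp [glue, prolong, zeroProlong]
  cont := by
    refine ContinuousMap.continuous_of_continuous_uncurry _ ?_
    simp only [Function.uncurry_def, glue, prolong, zeroProlong, ContinuousMap.add_apply,
      ContinuousMap.coe_mk]
    fun_prop

theorem norm_integOp_le (hS : 0 ≤ S) (g : CSeg n S) : ‖integOp hS g‖ ≤ S * ‖g‖ := by
  refine (ContinuousMap.norm_le _ (by positivity)).2 fun t => ?_
  have h := intervalIntegral.norm_integral_le_of_norm_le_const (a := 0) (b := (t : ℝ))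
    (f := fun s => g (projIcc 0 S hS s)) (C := ‖g‖) fun s _ => g.norm_coe_le_norm _
  rw [sub_zero, abs_of_nonneg t.2.1] at h
  calc _ ≤ ‖g‖ * (t : ℝ) := h
    _ ≤ ‖g‖ * S := by gcongr; exact t.2.2
    _ = S * ‖g‖ := mul_comm _ _

/-- `integOp` as a continuous linear map. -/
noncomputable def integCLM (n : ℕ) (hS : 0 ≤ S) : CSeg n S →L[ℝ] CSegZero n S :=
  LinearMap.mkContinuous
    { toFun := integOp hS
      map_add' := fun g g' => by
        ext1
        ext1 t
        have hi : ∀ g : CSeg n S, IntervalIntegrable (fun s => g (projIcc 0 S hS s))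
            MeasureTheory.volume 0 t := fun g =>
          (by fun_prop : Continuous fun s => g (projIcc 0 S hS s)).intervalIntegrable _ _
        exact intervalIntegral.integral_add (hi g) (hi g')
      map_smul' := fun c g => by
        ext1
        ext1 t
        exact intervalIntegral.integral_smul c _ } S (norm_integOp_le hS)

theorem norm_fixOp_sub_le (f : CPast n 0 → Rn n) (hS : 0 ≤ S) (η₁ η₂ : CSegZero n S)
    (χ : CPast n 0) : ‖fixOp f hS η₁ χ - fixOp f hS η₂ χ‖
      ≤ S * ‖substOp f (glue hS η₁ χ) - substOp f (glue hS η₂ χ)‖ := by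
  have h : fixOp f hS η₁ χ - fixOp f hS η₂ χ
      = integOp hS (substOp f (glue hS η₁ χ) - substOp f (glue hS η₂ χ)) :=
    (map_sub (integCLM n hS) _ _).symm
  rw [h]
  exact norm_integOp_le hS _

theorem isC1_fixOp {k : SmoothKind} {U : Set (CPast n 0)} (hU : IsOpen U)
    {f : CPast n 0 → Rn n} (hf : IsC1 k U f) (hS : 0 ≤ S)
    {O : Set (CSegZero n S × CPast n 0)} (hO : ∀ p ∈ O, glue hS p.1 p.2 ∈ segDom U S) :
    IsC1 k O (fun p => fixOp f hS p.1 p.2) := by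
  have := firstCountableTopology_cPast n 0
  have h1 := IsC1.comp_clm (V' := CSegZero n S × CPast n 0)
    (isC1_nemytskii (K := Icc (0 : ℝ) S) hU hf) ((segMap n S).comp (glueCLM n hS))
  have h2 := IsC1.clm_comp (Z := CSegZero n S) h1 (integCLM n hS)
  exact h2.mono fun p hp t _ => hO p hp t

theorem seg_glue_apply (hS : 0 ≤ S) (η : CSegZero n S) (χ : CPast n 0) (t : Iic S)
    (s : Iic (0 : ℝ)) : seg (glue hS η χ) t s
      = χ ⟨min ((t : ℝ) + s) 0, mem_Iic.2 (min_le_right _ _)⟩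
        + (η : CSeg n S) (projIcc 0 S hS ((t : ℝ) + s)) :=
  rfl

theorem seg_glue_zero (hS : 0 ≤ S) (η : CSegZero n S) (χ : CPast n 0) :
    seg (glue hS η χ) ⟨0, hS⟩ = χ := by
  ext1 s
  have hs : (s : ℝ) ≤ 0 := s.2
  have h0 : (η : CSeg n S) ⟨0, left_mem_Icc.2 hS⟩ = 0 := η.2 _
  rw [seg_glue_apply]
  simp [hs, projIcc_of_le_left hS, h0]

theorem isSolution_glue {U : Set (CPast n 0)} {f : CPast n 0 → Rn n} (hf : ContinuousOn f U)
    (hS : 0 ≤ S) {η : CSegZero n S} {χ : CPast n 0} (hdom : glue hS η χ ∈ segDom U S)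
    (hη : fixOp f hS η χ = η) : IsSolution f U (glue hS η χ) := by
  intro t
  refine ⟨hdom t, ?_⟩
  set g := substOp f (glue hS η χ) with hg
  have hgc : Continuous fun s => g (projIcc 0 S hS s) := by fun_prop
  have h1 : HasDerivAt (fun r : ℝ => χ ⟨0, mem_Iic.2 le_rfl⟩
      + ∫ s in (0 : ℝ)..r, g (projIcc 0 S hS s)) (g (projIcc 0 S hS t)) t :=
    (intervalIntegral.integral_hasDerivAt_right (hgc.intervalIntegrable _ _)
      (hgc.stronglyMeasurableAtFilter _ _) hgc.continuousAt).const_add _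
  have e1 : g (projIcc 0 S hS t) = f (seg (glue hS η χ) (toIic t)) := by
    rw [projIcc_val, hg, substOp_apply hf hdom]
  have e2 : ∀ r ∈ Icc (0 : ℝ) S, IicExtend (glue hS η χ) r
      = χ ⟨0, mem_Iic.2 le_rfl⟩ + ∫ s in (0 : ℝ)..r, g (projIcc 0 S hS s) := by
    intro r hr
    have e3 : (η : CSeg n S) (projIcc 0 S hS r) = ∫ s in (0 : ℝ)..r, g (projIcc 0 S hS s) := by
      conv_lhs => rw [← hη]
      rw [projIcc_of_mem hS hr]
      rfl
    rw [IicExtend_of_mem _ hr.2, ← e3]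
    have e4 : glue hS η χ ⟨r, hr.2⟩ = χ ⟨min r 0, mem_Iic.2 (min_le_right _ _)⟩
        + (η : CSeg n S) (projIcc 0 S hS r) := rfl
    rw [e4]
    congr 3
    exact min_eq_right hr.1
  rw [← e1]
  exact h1.hasDerivWithinAt.congr e2 (e2 t t.2)

end Operators

section LocalLipschitz

variable {α E F : Type*} [TopologicalSpace α] [NormedAddCommGroup E]

theorem ContinuousMap.exists_isCompact_of_mem_nhds_zero {M : Set C(α, E)} (hM : M ∈ 𝓝 0) :
    ∃ K : Set α, IsCompact K ∧ ∃ δ > 0, ∀ v : C(α, E), (∀ x ∈ K, ‖v x‖ < δ) → v ∈ M := by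
  obtain ⟨⟨K, δ⟩, ⟨hK, hδ⟩, h⟩ := (nhds_basis_uniformity'
    (Metric.uniformity_basis_dist (α := E)).compactConvergenceUniformity).mem_iff.1 hM
  refine ⟨K, hK, δ, hδ, fun v hv => h ?_⟩
  intro x hx
  simpa using hv x hx

variable [NormedSpace ℝ E] [NormedAddCommGroup F] [NormedSpace ℝ F]

theorem IsC1MB.exists_local_lipschitz {U : Set C(α, E)} (hU : IsOpen U) {f : C(α, E) → F}
    (hf : IsC1MB U f) {φ : C(α, E)} (hφ : φ ∈ U) :
    ∃ N ∈ 𝓝 φ, N ⊆ U ∧ ∃ K : Set α, ∃ L > 0, ∃ M > 0, (∀ u ∈ N, ‖f u‖ ≤ M) ∧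
      ∀ u ∈ N, ∀ v ∈ N, ∀ c > 0, (∀ x ∈ K, ‖u x - v x‖ ≤ c) → ‖f u - f v‖ ≤ L * c := by
  obtain ⟨hc, D, hD, hDc⟩ := hf
  have hsmul : ∀ u ∈ U, ∀ (c : ℝ) v, D u (c • v) = c • D u v := fun u hu c v =>
    (hD u hu (c • v)).unique ((hD u hu v).smul c)
  have h0 : D φ 0 = 0 := by simpa using hsmul φ hφ 0 0
  have hcont : ContinuousAt (fun p : C(α, E) × C(α, E) => ‖D p.1 p.2‖) (φ, 0) :=
    (hDc.continuousAt ((hU.prod isOpen_univ).mem_nhds ⟨hφ, mem_univ _⟩)).norm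
  have hev : ∀ᶠ p : C(α, E) × C(α, E) in 𝓝 (φ, 0), ‖D p.1 p.2‖ < 1 := by
    refine hcont.tendsto.eventually (gt_mem_nhds ?_)
    simp [h0]
  rw [nhds_prod_eq] at hev
  obtain ⟨P, hP, Q, hQ, hPQ⟩ := eventually_prod_iff.1 hev
  obtain ⟨K, -, δ, hδ, hK⟩ := ContinuousMap.exists_isCompact_of_mem_nhds_zero hQ
  have hfb : ∀ᶠ u in 𝓝 φ, ‖f u‖ < ‖f φ‖ + 1 :=
    (hc.continuousAt (hU.mem_nhds hφ)).norm.tendsto.eventually (gt_mem_nhds (lt_add_one _))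
  obtain ⟨N, ⟨hN, hNc⟩, hNs⟩ := (LocallyConvexSpace.convex_basis (𝕜 := ℝ) φ).mem_iff.1
    (hP.and (hfb.and (hU.mem_nhds hφ)))
  refine ⟨N, hN, fun u hu => (hNs hu).2.2, K, 2 / δ, by positivity, ‖f φ‖ + 1, by positivity,
    fun u hu => (hNs hu).2.1.le, ?_⟩
  intro u hu v hv c hcpos huv
  have hbound : ∀ w ∈ N, ‖D w (u - v)‖ ≤ 2 / δ * c := by
    intro w hw
    have h1 : ‖D w ((δ / (2 * c)) • (u - v))‖ < 1 := by
      refine hPQ (hNs hw).1 (hK _ fun x hx => ?_)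
      rw [ContinuousMap.smul_apply, ContinuousMap.sub_apply, norm_smul, Real.norm_of_nonneg
        (by positivity)]
      calc δ / (2 * c) * ‖u x - v x‖ ≤ δ / (2 * c) * c := by gcongr; exact huv x hx
        _ = δ / 2 := by field_simp
        _ < δ := half_lt_self hδ
    rw [hsmul w (hNs hw).2.2, norm_smul, Real.norm_of_nonneg (by positivity)] at h1
    have h2 : δ / (2 * c) * (2 / δ * c) = 1 := by field_simp
    by_contra! h3
    have h4 : δ / (2 * c) * (2 / δ * c) < δ / (2 * c) * ‖D w (u - v)‖ := by gcongr
    linarith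
  have hline : ∀ r ∈ Icc (0 : ℝ) 1, v + r • (u - v) ∈ N := fun r hr =>
    hNc.add_smul_sub_mem hv hu hr
  have h := norm_sub_sub_smul_le_of_hasDirDeriv (f := f) (D := D) (u := v) (v := u - v)
    (convex_Icc (0 : ℝ) 1) (fun r hr => hD _ (hNs (hline r hr)).2.2 _) (w := 0) (c := 2 / δ * c)
    (fun r hr => by simpa using hbound _ (hline r hr)) (left_mem_Icc.2 zero_le_one)
    (right_mem_Icc.2 zero_le_one)
  simpa using h

end LocalLipschitz

section ContractionData

variable {n : ℕ}

/-- The segment at `s` of the prolongation of `χ` by its value at `0`. -/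
def prolongSeg (χ : CPast n 0) (s : ℝ) : CPast n 0 where
  toFun σ := χ ⟨min (s + σ) 0, mem_Iic.2 (min_le_right _ _)⟩
  continuous_toFun := by fun_prop

theorem continuous_prolongSeg :
    Continuous fun p : CPast n 0 × ℝ => prolongSeg p.1 p.2 := by
  refine ContinuousMap.continuous_of_continuous_uncurry _ ?_
  simp only [Function.uncurry_def, prolongSeg, ContinuousMap.coe_mk]
  fun_prop

theorem prolongSeg_zero (χ : CPast n 0) : prolongSeg χ 0 = χ := by
  ext1 s
  have hs : (s : ℝ) ≤ 0 := s.2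
  simp [prolongSeg, hs]

theorem exists_seg_glue_mem {φ : CPast n 0} {N : Set (CPast n 0)} (hN : N ∈ 𝓝 φ) :
    ∃ ε > 0, ∃ S₁ > 0, ∃ W ∈ 𝓝 φ, ∀ (S : ℝ) (hS : 0 ≤ S), S < S₁ → ∀ χ ∈ W,
      ∀ η : CSegZero n S, ‖η‖ ≤ ε / 2 → ∀ t : Icc (0 : ℝ) S,
        seg (glue hS η χ) (toIic t) ∈ N := by
  have h1 : ∀ᶠ p : CPast n 0 × CPast n 0 in 𝓝 (φ, 0), p.1 + p.2 ∈ N := by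
    have h2 : Tendsto (fun p : CPast n 0 × CPast n 0 => p.1 + p.2) (𝓝 (φ, 0)) (𝓝 φ) := by
      simpa using (continuous_add (M := CPast n 0)).tendsto (φ, 0)
    exact h2.eventually hN
  rw [nhds_prod_eq] at h1
  obtain ⟨A, hA, B, hB, hAB⟩ := eventually_prod_iff.1 h1
  obtain ⟨K, -, ε, hε, hK⟩ := ContinuousMap.exists_isCompact_of_mem_nhds_zero hB
  have h3 : ∀ᶠ p : CPast n 0 × ℝ in 𝓝 (φ, 0), A (prolongSeg p.1 p.2) := by
    have h4 := continuous_prolongSeg.tendsto (φ, (0 : ℝ))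
    rw [prolongSeg_zero] at h4
    exact h4.eventually hA
  rw [nhds_prod_eq] at h3
  obtain ⟨P, hP, Q, hQ, hPQ⟩ := eventually_prod_iff.1 h3
  obtain ⟨S₁, hS₁, hball⟩ := Metric.eventually_nhds_iff.1 hQ
  refine ⟨ε, hε, S₁, hS₁, {χ | P χ}, hP, ?_⟩
  intro S hS hSS χ hχ η hη t
  have h5 : A (prolongSeg χ t) := hPQ hχ (hball (by
    rw [Real.dist_eq, sub_zero, abs_of_nonneg t.2.1]
    exact t.2.2.trans_lt hSS))
  have h6 : B (seg (zeroProlong hS η) (toIic t)) := hK _ fun x _ =>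
    lt_of_le_of_lt ((ContinuousMap.norm_coe_le_norm (η : CSeg n S) _).trans hη) (half_lt_self hε)
  exact hAB h5 h6

theorem exists_isContractionData {U : Set (CPast n 0)} (hU : IsOpen U) {f : CPast n 0 → Rn n}
    (hf : IsC1MB U f) {φ : CPast n 0} (hφ : φ ∈ U) :
    ∃ (ε S₀ : ℝ) (W : Set (CPast n 0)), IsContractionData f U φ ε S₀ W := by
  obtain ⟨N, hN, hNU, K, L, hL, M, hM, hfM, hfL⟩ := hf.exists_local_lipschitz hU hφ
  obtain ⟨ε, hε, S₁, hS₁, W, hW, hseg⟩ := exists_seg_glue_mem hN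
  have hS₀ : 0 < min (S₁ / 2) (min (ε / (4 * M)) (1 / (2 * L))) := by positivity
  have hmem : ∀ (S : ℝ) (hS : 0 < S), S ≤ min (S₁ / 2) (min (ε / (4 * M)) (1 / (2 * L))) →
      ∀ χ ∈ interior W ∩ U, ∀ η : CSegZero n S, ‖η‖ ≤ ε / 2 → ∀ t : Icc (0 : ℝ) S,
        seg (glue hS.le η χ) (toIic t) ∈ N := fun S hS hSS χ hχ η hη t =>
    hseg S hS.le ((hSS.trans (min_le_left _ _)).trans_lt (half_lt_self hS₁)) χ
      (interior_subset hχ.1) η hη t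
  have hdom : ∀ (S : ℝ) (hS : 0 < S), S ≤ min (S₁ / 2) (min (ε / (4 * M)) (1 / (2 * L))) →
      ∀ χ ∈ interior W ∩ U, ∀ η : CSegZero n S, ‖η‖ ≤ ε / 2 → glue hS.le η χ ∈ segDom U S :=
    fun S hS hSS χ hχ η hη t => hNU (hmem S hS hSS χ hχ η hη t)
  refine ⟨ε, _, interior W ∩ U, hε, hS₀, isOpen_interior.inter hU,
    ⟨mem_interior_iff_mem_nhds.2 hW, hφ⟩, inter_subset_right, hdom, ?_, ?_⟩
  · intro S hS hSS χ hχ η hη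
    have h1 : S * M ≤ ε / 4 := by
      have h2 := (hSS.trans (min_le_right _ _)).trans (min_le_left _ _)
      rw [le_div_iff₀ (by positivity)] at h2
      linarith
    have h3 : ‖substOp f (glue hS.le η χ)‖ ≤ M := by
      refine (ContinuousMap.norm_le _ hM.le).2 fun t => ?_
      rw [substOp_apply hf.1 (hdom S hS hSS χ hχ η hη)]
      exact hfM _ (hmem S hS hSS χ hχ η hη t)
    calc ‖fixOp f hS.le η χ‖ ≤ S * ‖substOp f (glue hS.le η χ)‖ := norm_integOp_le hS.le _
      _ ≤ S * M := by gcongr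
      _ < ε / 2 := by linarith
  · intro S hS hSS χ hχ η₁ η₂ hη₁ hη₂
    have h1 : S * L ≤ 1 / 2 := by
      have h2 := (hSS.trans (min_le_right _ _)).trans (min_le_right _ _)
      rw [le_div_iff₀ (by positivity)] at h2
      linarith
    have h3 : ‖substOp f (glue hS.le η₁ χ) - substOp f (glue hS.le η₂ χ)‖ ≤ L * ‖η₁ - η₂‖ := by
      rcases eq_or_ne η₁ η₂ with rfl | hne
      · rw [sub_self, norm_zero]
        positivity
      have hpos : 0 < ‖η₁ - η₂‖ := norm_pos_iff.2 (sub_ne_zero.2 hne)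
      refine (ContinuousMap.norm_le _ (by positivity)).2 fun t => ?_
      rw [ContinuousMap.sub_apply, substOp_apply hf.1 (hdom S hS hSS χ hχ η₁ hη₁),
        substOp_apply hf.1 (hdom S hS hSS χ hχ η₂ hη₂)]
      refine hfL _ (hmem S hS hSS χ hχ η₁ hη₁ t) _ (hmem S hS hSS χ hχ η₂ hη₂ t) _ hpos
        fun x _ => ?_
      rw [seg_glue_apply, seg_glue_apply, add_sub_add_left_eq_sub]
      exact ContinuousMap.norm_coe_le_norm ((η₁ - η₂ : CSegZero n S) : CSeg n S) _
    calc _ ≤ S * ‖substOp f (glue hS.le η₁ χ) - substOp f (glue hS.le η₂ χ)‖ :=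
          norm_fixOp_sub_le f hS.le η₁ η₂ χ
      _ ≤ S * (L * ‖η₁ - η₂‖) := by gcongr
      _ = S * L * ‖η₁ - η₂‖ := by ring
      _ ≤ 1 / 2 * ‖η₁ - η₂‖ := by gcongr

end ContractionData

theorem proposition3p5 (n : ℕ) (k : SmoothKind) (U : Set (CPast n 0)) (hU : IsOpen U)
    (f : CPast n 0 → Rn n) (hf : IsC1 k U f) (φ : CPast n 0) (hφ : φ ∈ U) :
    (∃ (ε S₀ : ℝ) (W : Set (CPast n 0)), IsContractionData f U φ ε S₀ W) ∧
    ∀ (ε S₀ : ℝ) (W : Set (CPast n 0)), IsContractionData f U φ ε S₀ W →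
      ∀ (S : ℝ) (hS : 0 < S), S ≤ S₀ →
        ∃ η : CPast n 0 → CSegZero n S,
          (∀ χ ∈ W, ‖η χ‖ ≤ ε / 2 ∧ fixOp f hS.le (η χ) χ = η χ ∧
            ∀ ζ : CSegZero n S, ‖ζ‖ ≤ ε / 2 → fixOp f hS.le ζ χ = ζ → ζ = η χ) ∧
          (∀ χ ∈ W, IsSolution f U (glue hS.le (η χ) χ) ∧
            seg (glue hS.le (η χ) χ) ⟨0, hS.le⟩ = χ) ∧
          ∀ t : Icc (0 : ℝ) S, IsC1 k W (fun χ => seg (glue hS.le (η χ) χ) (toIic t)) := by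
  have hMB : IsC1MB U f := hf.isC1MB hU
  refine ⟨exists_isContractionData hU hMB hφ, ?_⟩
  intro ε S₀ W hdata S hS hSS
  have := completeSpace_cSegZero n S
  have hex : ∀ χ, ∃ x : CSegZero n S, χ ∈ W → ‖x‖ ≤ ε / 2 ∧ fixOp f hS.le x χ = x := by
    intro χ
    by_cases hχ : χ ∈ W
    · obtain ⟨x, hx⟩ := exists_fixedPoint_of_norm_le (g := fun x => fixOp f hS.le x χ)
        (half_pos hdata.eps_pos).le (fun x hx => (hdata.bound S hS hSS χ hχ x hx).le)
        (hdata.contract S hS hSS χ hχ)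
      exact ⟨x, fun _ => hx⟩
    · exact ⟨0, fun h => absurd h hχ⟩
  choose η hη using hex
  have hdom : ∀ χ ∈ W, glue hS.le (η χ) χ ∈ segDom U S := fun χ hχ =>
    hdata.dom S hS hSS χ hχ _ (hη χ hχ).1
  have hlt : ∀ χ ∈ W, ‖η χ‖ < ε / 2 ∧ fixOp f hS.le (η χ) χ = η χ := by
    intro χ hχ
    have h := hdata.bound S hS hSS χ hχ _ (hη χ hχ).1
    rw [(hη χ hχ).2] at h
    exact ⟨h, (hη χ hχ).2⟩
  refine ⟨η, fun χ hχ => ⟨(hη χ hχ).1, (hη χ hχ).2, fun ζ hζ hfix => ?_⟩,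
    fun χ hχ => ⟨isSolution_glue hMB.1 hS.le (hdom χ hχ) (hη χ hχ).2, seg_glue_zero _ _ _⟩,
    fun t => ?_⟩
  · have h := hdata.contract S hS hSS χ hχ ζ (η χ) hζ (hη χ hχ).1
    rw [hfix, (hη χ hχ).2] at h
    have h0 := norm_nonneg (ζ - η χ)
    exact sub_eq_zero.1 (norm_eq_zero.1 (by linarith))
  · have h1 : IsC1 k (Metric.ball (0 : CSegZero n S) (ε / 2) ×ˢ W)
        (fun p => fixOp f hS.le p.1 p.2) :=
      isC1_fixOp hU hf hS.le fun p hp => by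
        have hp1 : ‖p.1‖ < ε / 2 := (mem_ball_zero_iff (E := CSegZero n S)).1 hp.1
        exact hdata.dom S hS hSS p.2 hp.2 p.1 hp1.le
    have h2 : IsC1 k W η := isC1_fixedPoint (E := CSegZero n S) (X := CPast n 0)
      (G := fun p => fixOp f hS.le p.1 p.2) (r := ε / 2) hdata.isOpen (hdata.contract S hS hSS) hlt h1
    let A : CSegZero n S × CPast n 0 →L[ℝ] CPast n 0 :=
      (ContinuousMap.evalCLM ℝ t).comp ((segMap n S).comp (glueCLM n hS.le))
    have h3 := h2.clm_comp_add_clm (A.comp (ContinuousLinearMap.inl ℝ _ _))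
      (A.comp (ContinuousLinearMap.inr ℝ _ _))
    have e : (fun χ => seg (glue hS.le (η χ) χ) (toIic t))
        = fun χ => A.comp (ContinuousLinearMap.inl ℝ _ _) (η χ)
          + A.comp (ContinuousLinearMap.inr ℝ _ _) χ := by
      funext χ
      have h4 : A (η χ, χ) = A (η χ, 0) + A (0, χ) := by
        rw [← map_add]
        simp
      exact h4
    rw [e]
    exact h3
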